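/- Let $M=\{(x,y)\in\mathbb R^2:\ -1\le x\le 1,\ \tfrac{x^4}{2}-\tfrac{x^2}{2}\le y\le 1-x^2\}$ (the "bean"), with the distance $d$ induced by the Euclidean metric (infimum of the lengths of curves in $M$ joining two points), let $h(x,y)=y$, $\Sigma=M\cap\{y=0\}$, $M_\pm=M\cap\{\pm y>0\}$, and let $Z=(Z_+,Z_-)$ be the Filippov system (the bean model) with $$Z_+(x,y)=(1,-2x)\ \text{ on } y>0,\qquad Z_-(x,y)=(-2,\,2x-4x^3)\ \text{ on } y<0 .$$ Write $Z_\pm h=\nabla h\cdot Z_\pm$. The tangency points are the points of $\Sigma$ with $Z_+h\,Z_-h=0$; on the sliding set $\{p\in\Sigma: Z_+h\,Z_-h<0\}$ the sliding field is $Z_s=\frac{Z_-h\,Z_+-Z_+h\,Z_-}{Z_-h-Z_+h}$. An orbit of $Z$ is a continuous curve $\gamma:\mathbb R\to M$ that is a concatenation, glued at points of $\Sigma$ and with finitely many pieces in every bounded time interval, of integral curves of $Z_+$ in $M_+$, of $Z_-$ in $M_-$ and of $Z_s$ in the sliding set. The orbit space $\widetilde M$ is the set of all orbits, with the distance $\widetilde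 d(\gamma_0,\gamma_1)=\sum_{i\in\mathbb Z}2^{-|i|}\int_i^{i+1}d(\gamma_0(t),\gamma_1(t))\,dt$ and the flow $\widetilde\Phi^t(\gamma)(s)=\gamma(t+s)$. Then: 1. The tangency points of $Z$ are exactly $(0,0)$ and $(\pm\tfrac{\sqrt2}{2},0)$. Among them, the origin is the only one through which every orbit passes infinitely often both forward and backward in time (for every orbit $\gamma$ and every $\tau\in\mathbb R$ there are $t>\tau$ and $t'<\tau$ with $\gamma(t)=\gamma(t')=(0,0)$). 2. The flow $\widetilde\Phi$ is topologically transitive on $\widetilde M$ (for all nonempty open $U,V\subseteq\widetilde M$ there is $t>0$ with $\widetilde\Phi^t(U)\cap V\ne\emptyset$), and it is transitive: there is $\gamma\in\widetilde M$ such that $\{\widetilde\Phi^t(\gamma):t\in\mathbb R\}$ is dense in $\widetilde M$. -/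

import Mathlib

open Set
open scoped ENNReal ContDiff

noncomputable section

/-- The data of a nonsmooth (Filippov) vector field `Z = (Z₊, Z₋)` on a subset `carrier` (the phase
space `M`) of a normed space `E`, with discontinuity set `Σ = {p ∈ M | h p = 0}`. -/
structure FilippovSystem (E : Type*) [NormedAddCommGroup E] [NormedSpace ℝ E] where
  /-- the phase space `M` -/
  carrier : Set E
  /-- the switching function -/
  h : E → ℝ
  /-- the vector field `Z₊`, active where `h > 0` -/
  Zpos : E → E
  /-- the vector field `Z₋`, active where `h < 0` -/
  Zneg : E → E
  contDiff_h : ContDiff ℝ ∞ h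
  contDiff_Zpos : ContDiff ℝ ∞ Zpos
  contDiff_Zneg : ContDiff ℝ ∞ Zneg
  regular_zero : ∀ p ∈ carrier, h p = 0 → fderiv ℝ h p ≠ 0

namespace FilippovSystem

variable {E : Type*} [NormedAddCommGroup E] [NormedSpace ℝ E] (S : FilippovSystem E)

/-- The Lie derivative `Z₊h`. -/
def lieDerivPos (p : E) : ℝ := fderiv ℝ S.h p (S.Zpos p)

/-- The Lie derivative `Z₋h`. -/
def lieDerivNeg (p : E) : ℝ := fderiv ℝ S.h p (S.Zneg p)

/-- The region `M₊`. -/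
def posRegion : Set E := {p | p ∈ S.carrier ∧ 0 < S.h p}

/-- The region `M₋`. -/
def negRegion : Set E := {p | p ∈ S.carrier ∧ S.h p < 0}

/-- The discontinuity set `Σ`. -/
def switchingSet : Set E := {p | p ∈ S.carrier ∧ S.h p = 0}

/-- The set of tangency points. -/
def tangencySet : Set E := {p | p ∈ S.switchingSet ∧ S.lieDerivPos p * S.lieDerivNeg p = 0}

/-- The (stable or unstable) sliding region. -/
def slidingSet : Set E := {p | p ∈ S.switchingSet ∧ S.lieDerivPos p * S.lieDerivNeg p < 0}

/-- The sliding vector field `Z_s`. -/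
def slidingField (p : E) : E :=
  (S.lieDerivNeg p - S.lieDerivPos p)⁻¹ •
    (S.lieDerivNeg p • S.Zpos p - S.lieDerivPos p • S.Zneg p)

/-- Near time `t`, the curve `γ` is an integral curve of `Z₊` in `M₊`, or of `Z₋` in `M₋`, or of
`Z_s` in the sliding region. -/
def IsSmoothPieceAt (γ : ℝ → E) (t : ℝ) : Prop :=
  ∃ ε > 0,
    (∀ s ∈ Ioo (t - ε) (t + ε), γ s ∈ S.posRegion ∧ HasDerivAt γ (S.Zpos (γ s)) s) ∨
    (∀ s ∈ Ioo (t - ε) (t + ε), γ s ∈ S.negRegion ∧ HasDerivAt γ (S.Zneg (γ s)) s) ∨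
    (∀ s ∈ Ioo (t - ε) (t + ε), γ s ∈ S.slidingSet ∧ HasDerivAt γ (S.slidingField (γ s)) s)

/-- Filippov orbits defined for all times: continuous curves in `M` for which there is a set `B` of
gluing times, finite in every bounded interval, such that `γ` lies on `Σ` at every gluing time and
consists, away from the gluing times, of pieces of integral curves of `Z₊`, `Z₋` or `Z_s`. -/
def IsOrbit (γ : ℝ → E) : Prop :=
  Continuous γ ∧ (∀ t, γ t ∈ S.carrier) ∧
    ∃ B : Set ℝ, (∀ a b : ℝ, (B ∩ Icc a b).Finite) ∧
      (∀ t ∈ B, γ t ∈ S.switchingSet) ∧ ∀ t ∉ B, S.IsSmoothPieceAt γ t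

/-- The orbit space: the set of all orbits of `Z`. -/
def OrbitSpace : Type _ := {γ : ℝ → E // S.IsOrbit γ}

instance : CoeFun S.OrbitSpace fun _ => ℝ → E := ⟨Subtype.val⟩

variable {S} in
theorem IsSmoothPieceAt.shift {γ : ℝ → E} {t u : ℝ} (h : S.IsSmoothPieceAt γ (t + u)) :
    S.IsSmoothPieceAt (fun s => γ (t + s)) u := by
  obtain ⟨ε, hε, h⟩ := h
  have key : ∀ s ∈ Ioo (u - ε) (u + ε), t + s ∈ Ioo (t + u - ε) (t + u + ε) := fun s hs =>
    ⟨by linarith [hs.1], by linarith [hs.2]⟩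
  refine ⟨ε, hε, ?_⟩
  rcases h with h | h | h
  · exact Or.inl fun s hs => ⟨(h _ (key s hs)).1, (h _ (key s hs)).2.comp_const_add t s⟩
  · exact Or.inr (Or.inl fun s hs => ⟨(h _ (key s hs)).1, (h _ (key s hs)).2.comp_const_add t s⟩)
  · exact Or.inr (Or.inr fun s hs => ⟨(h _ (key s hs)).1, (h _ (key s hs)).2.comp_const_add t s⟩)

variable {S} in
theorem IsOrbit.shift {γ : ℝ → E} (h : S.IsOrbit γ) (t : ℝ) :
    S.IsOrbit fun s => γ (t + s) := by
  obtain ⟨hc, hm, B, hB, hBs, hp⟩ := h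
  refine ⟨hc.comp (continuous_const.add continuous_id), fun s => hm _,
    (fun s => t + s) ⁻¹' B, fun a b => ?_, fun s hs => hBs _ hs, fun s hs => (hp _ hs).shift⟩
  refine ((hB (t + a) (t + b)).preimage (add_right_injective t).injOn).subset ?_
  rintro s ⟨hs, ha, hb⟩
  exact ⟨hs, by simpa using ha, by simpa using hb⟩

/-- The flow on the orbit space, `(flow t γ) s = γ (t + s)`. -/
def flow (t : ℝ) (γ : S.OrbitSpace) : S.OrbitSpace := ⟨fun s => γ (t + s), γ.2.shift t⟩

/-- The distance on the phase space `M` induced by the ambient metric: the infimum of the lengths of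
the continuous curves in `M` that join the two points. -/
def pathDist (p q : E) : ℝ :=
  (⨅ (c : ℝ → E) (_ : ContinuousOn c (Icc 0 1)) (_ : MapsTo c (Icc 0 1) S.carrier)
    (_ : c 0 = p) (_ : c 1 = q), eVariationOn c (Icc 0 1)).toReal

/-- The integral distance on the orbit space. -/
def orbitDist (γ₀ γ₁ : S.OrbitSpace) : ℝ :=
  ∑' i : ℤ, 1 / 2 ^ i.natAbs * ∫ t in (i : ℝ)..(i + 1), S.pathDist (γ₀ t) (γ₁ t)

/-- The topology of the integral distance: a set is open if it contains a ball around each of its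
points. -/
instance : TopologicalSpace S.OrbitSpace where
  IsOpen U := ∀ γ ∈ U, ∃ ε > 0, ∀ γ', S.orbitDist γ γ' < ε → γ' ∈ U
  isOpen_univ := fun _ _ => ⟨1, one_pos, fun _ _ => mem_univ _⟩
  isOpen_inter := by
    rintro U V hU hV γ ⟨hγU, hγV⟩
    obtain ⟨ε, hε, h⟩ := hU γ hγU
    obtain ⟨δ, hδ, h'⟩ := hV γ hγV
    exact ⟨min ε δ, lt_min hε hδ, fun γ' hd =>
      ⟨h γ' (hd.trans_le (min_le_left _ _)), h' γ' (hd.trans_le (min_le_right _ _))⟩⟩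
  isOpen_sUnion := by
    rintro 𝒰 h𝒰 γ ⟨U, hU, hγ⟩
    obtain ⟨ε, hε, h⟩ := h𝒰 U hU γ hγ
    exact ⟨ε, hε, fun γ' hd => ⟨U, hU, h γ' hd⟩⟩

/-- Every orbit of `Z` passes through `p` infinitely often, at arbitrarily late positive times and
at arbitrarily early negative times. -/
def EveryOrbitRecursThrough (p : E) : Prop :=
  ∀ γ : S.OrbitSpace, ∀ τ : ℝ, (∃ t > τ, γ t = p) ∧ (∃ t < τ, γ t = p)

end FilippovSystem

/-- Topological transitivity of a flow. -/
def IsTopTransitiveFlow {X : Type*} [TopologicalSpace X] (Φ : ℝ → X → X) : Prop :=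
  ∀ U V : Set X, IsOpen U → IsOpen V → U.Nonempty → V.Nonempty →
    ∃ t > 0, (Φ t '' U ∩ V).Nonempty

/-- Transitivity of a flow: there is a dense orbit. -/
def IsTransitiveFlow {X : Type*} [TopologicalSpace X] (Φ : ℝ → X → X) : Prop :=
  ∃ x : X, Dense (range fun t => Φ t x)

/-- The bean: the region of the plane enclosed by `y = 1 - x²` and `y = x⁴/2 - x²/2`. -/
def beanRegion : Set (EuclideanSpace ℝ (Fin 2)) :=
  {p | -1 ≤ p 0 ∧ p 0 ≤ 1 ∧ (p 0) ^ 4 / 2 - (p 0) ^ 2 / 2 ≤ p 1 ∧ p 1 ≤ 1 - (p 0) ^ 2}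

/-- The bean model system: on the bean, `Z₊(x, y) = (1, -2x)` where `y > 0` and
`Z₋(x, y) = (-2, 2x - 4x³)` where `y < 0`. -/
def beanSystem : FilippovSystem (EuclideanSpace ℝ (Fin 2)) where
  carrier := beanRegion
  h := fun p => p 1
  Zpos := fun p => !₂[1, -2 * p 0]
  Zneg := fun p => !₂[-2, 2 * p 0 - 4 * (p 0) ^ 3]
  contDiff_h := by fun_prop
  contDiff_Zpos := by
    rw [contDiff_euclidean]
    intro i
    fin_cases i
    · simpa using contDiff_const
    · simp only [Fin.mk_one, Matrix.cons_val_one, Matrix.cons_val_fin_one]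
      fun_prop
  contDiff_Zneg := by
    rw [contDiff_euclidean]
    intro i
    fin_cases i
    · simpa using contDiff_const
    · simp only [Fin.mk_one, Matrix.cons_val_one, Matrix.cons_val_fin_one]
      fun_prop
  regular_zero := by
    intro p _ _ h0
    have h1 : HasFDerivAt (fun q : EuclideanSpace ℝ (Fin 2) => q 1)
        (EuclideanSpace.proj (1 : Fin 2) : EuclideanSpace ℝ (Fin 2) →L[ℝ] ℝ) p :=
      (EuclideanSpace.proj (1 : Fin 2) : EuclideanSpace ℝ (Fin 2) →L[ℝ] ℝ).hasFDerivAt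
    rw [h1.fderiv] at h0
    have h2 := DFunLike.congr_fun h0 (!₂[0, 1] : EuclideanSpace ℝ (Fin 2))
    simp at h2

end

/-! Everything rests on the origin lying in `Σ` and being visited by every orbit at arbitrarily late
and arbitrarily early times. Orbits are not unique there: two orbits passing through the same point
of `Σ` can be concatenated (`IsOrbit.concat`). One can thus follow any orbit up to a late visit to
the origin and then switch to any other orbit before an early visit of its own. Since the integral
distance is small when curves are close on a large compact interval (`OrbitDistControlled`), this
gives topological transitivity. Appending long windows of a countable family of orbits, dense for
the compact-open topology, gives a dense orbit.

Recurrence comes from the function `x - 2x/√(x² + max y 0)`, bounded by 3 on the bean and continuous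
off the origin. In `M₊` the quantity `c = x² + y ≤ 1` is conserved, so its derivative is `1 - 2/√c ≤
-1`. For `y ≤ 0` and `x ≠ 0` it equals `x ∓ 2`, so it has the speed of `x`, which is `-2` in `M₋`
and at most `-1/2` when sliding. An orbit avoiding the origin for long would push it below its lower
bound (`bean_exists_eq_zero`).

The other tangency points are excluded by the periodic boundary orbit, which meets `Σ` only where
`x` is `0` or `±1`. -/

open Filter Topology

/-! ### Locality and gluing of orbits -/

namespace FilippovSystem

/-- The curve that follows `γ` up to the time `a` and `γ'` from its time `b` on. -/
noncomputable def concat {X : Type*} (γ γ' : ℝ → X) (a b : ℝ) (t : ℝ) : X :=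
  if t ≤ a then γ t else γ' (t - a + b)

theorem concat_of_le {X : Type*} {γ γ' : ℝ → X} {a b t : ℝ} (h : t ≤ a) :
    concat γ γ' a b t = γ t :=
  if_pos h

theorem concat_of_ge {X : Type*} {γ γ' : ℝ → X} {a b t : ℝ} (hab : γ a = γ' b) (h : a ≤ t) :
    concat γ γ' a b t = γ' (t - a + b) := by
  rcases h.eq_or_lt with rfl | h
  · simp [concat, hab]
  · exact if_neg h.not_ge

variable {E : Type*} [NormedAddCommGroup E] [NormedSpace ℝ E] {S : FilippovSystem E}

theorem IsSmoothPieceAt.congr {γ γ' : ℝ → E} {t : ℝ} (h : S.IsSmoothPieceAt γ t)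
    (he : γ =ᶠ[𝓝 t] γ') : S.IsSmoothPieceAt γ' t := by
  obtain ⟨ε, hε, h⟩ := h
  obtain ⟨δ, hδ, hd⟩ := Metric.eventually_nhds_iff.1 he.eventuallyEq_nhds
  have key : ∀ s ∈ Ioo (t - min ε δ) (t + min ε δ),
      s ∈ Ioo (t - ε) (t + ε) ∧ γ =ᶠ[𝓝 s] γ' := by
    intro s hs
    have h1 := min_le_left ε δ
    have h2 := min_le_right ε δ
    refine ⟨⟨by linarith [hs.1], by linarith [hs.2]⟩, hd ?_⟩
    rw [Real.dist_eq, abs_lt]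
    exact ⟨by linarith [hs.1], by linarith [hs.2]⟩
  refine ⟨min ε δ, lt_min hε hδ, ?_⟩
  have tr : ∀ (A : Set E) (F : E → E),
      (∀ s ∈ Ioo (t - ε) (t + ε), γ s ∈ A ∧ HasDerivAt γ (F (γ s)) s) →
      ∀ s ∈ Ioo (t - min ε δ) (t + min ε δ), γ' s ∈ A ∧ HasDerivAt γ' (F (γ' s)) s := by
    intro A F hA s hs
    obtain ⟨h1, h2⟩ := key s hs
    rw [← h2.eq_of_nhds]
    exact ⟨(hA s h1).1, (hA s h1).2.congr_of_eventuallyEq h2.symm⟩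
  exact h.imp (tr _ _) (Or.imp (tr _ _) (tr _ _))

variable (S) in
/-- The local condition on a curve at the time `t` that characterizes orbits. -/
def IsOrbitNear (γ : ℝ → E) (t : ℝ) : Prop :=
  ContinuousAt γ t ∧ γ t ∈ S.carrier ∧ (∀ᶠ s in 𝓝[≠] t, S.IsSmoothPieceAt γ s) ∧
    (S.IsSmoothPieceAt γ t ∨ γ t ∈ S.switchingSet)

theorem IsOrbitNear.congr {γ γ' : ℝ → E} {t : ℝ} (h : S.IsOrbitNear γ t)
    (he : γ =ᶠ[𝓝 t] γ') : S.IsOrbitNear γ' t := by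
  obtain ⟨h1, h2, h3, h4⟩ := h
  refine ⟨h1.congr he, he.eq_of_nhds ▸ h2, ?_, ?_⟩
  · filter_upwards [h3, he.eventuallyEq_nhds.filter_mono nhdsWithin_le_nhds] with s hs hs'
    exact hs.congr hs'
  · rw [← he.eq_of_nhds]
    exact h4.imp (fun h => h.congr he) id

/-- Being an orbit is a local property in time, so glued curves and limits of curves can be checked
one time at a time. -/
theorem isOrbit_iff_forall_isOrbitNear {γ : ℝ → E} :
    S.IsOrbit γ ↔ ∀ t, S.IsOrbitNear γ t := by
  constructor
  · rintro ⟨hc, hm, B, hB, hBs, hp⟩ t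
    refine ⟨hc.continuousAt, hm t, ?_, ?_⟩
    · have hfin : ((B ∩ Icc (t - 1) (t + 1)) \ {t}).Finite := (hB _ _).subset sdiff_subset
      have h1 : ((B ∩ Icc (t - 1) (t + 1)) \ {t})ᶜ ∈ 𝓝 t :=
        hfin.isClosed.isOpen_compl.mem_nhds (by simp)
      have h2 : Icc (t - 1) (t + 1) ∈ 𝓝 t := Icc_mem_nhds (by linarith) (by linarith)
      filter_upwards [nhdsWithin_le_nhds h1, nhdsWithin_le_nhds h2, self_mem_nhdsWithin]
        with s hs1 hs2 hs3
      exact hp s fun hsB => hs1 ⟨⟨hsB, hs2⟩, hs3⟩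
    · by_cases ht : t ∈ B
      · exact Or.inr (hBs t ht)
      · exact Or.inl (hp t ht)
  · intro h
    refine ⟨continuous_iff_continuousAt.2 fun t => (h t).1, fun t => (h t).2.1,
      {t | ¬ S.IsSmoothPieceAt γ t}, fun a b => ?_, fun t ht => (h t).2.2.2.resolve_left ht,
      fun t ht => not_not.1 ht⟩
    -- Infinitely many non-smooth times in a compact interval would accumulate at some `t`, against
    -- the punctured-neighbourhood condition there.
    by_contra hinf
    obtain ⟨t, -, ht⟩ := Set.Infinite.exists_accPt_of_subset_isCompact hinf
      (isCompact_Icc (a := a) (b := b)) inter_subset_right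
    rw [accPt_iff_frequently_nhdsNE] at ht
    exact ht ((h t).2.2.1.mono fun s hs hs' => hs'.1 hs)

/-- Two orbits that pass through the same point of the discontinuity set can be concatenated. -/
theorem IsOrbit.concat {γ γ' : ℝ → E} {a b : ℝ} (h : S.IsOrbit γ) (h' : S.IsOrbit γ')
    (hab : γ a = γ' b) (ha : γ a ∈ S.switchingSet) : S.IsOrbit (concat γ γ' a b) := by
  have h'' : S.IsOrbit fun t => γ' (t - a + b) := by
    have := h'.shift (b - a)
    refine (congrArg S.IsOrbit (funext fun t => ?_)).mp this
    ring_nf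
  rw [isOrbit_iff_forall_isOrbitNear] at h h'' ⊢
  have hL : ∀ t < a, γ =ᶠ[𝓝 t] FilippovSystem.concat γ γ' a b := fun t ht => by
    filter_upwards [Iio_mem_nhds ht] with s hs
    exact (concat_of_le (le_of_lt hs)).symm
  have hR : ∀ t > a, (fun t => γ' (t - a + b)) =ᶠ[𝓝 t] FilippovSystem.concat γ γ' a b :=
    fun t ht => by
      filter_upwards [Ioi_mem_nhds ht] with s hs
      exact (concat_of_ge hab (le_of_lt hs)).symm
  intro t
  rcases lt_trichotomy t a with ht | rfl | ht
  · exact (h t).congr (hL t ht)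
  · have hv : FilippovSystem.concat γ γ' t b t = γ t := concat_of_le le_rfl
    refine ⟨?_, hv ▸ (h t).2.1, ?_, Or.inr (hv ▸ ha)⟩
    · rw [continuousAt_iff_continuous_left_right]
      refine ⟨(h t).1.continuousWithinAt.congr (fun s hs => concat_of_le hs) hv,
        (h'' t).1.continuousWithinAt.congr (fun s hs => concat_of_ge hab hs)
          (concat_of_ge hab le_rfl)⟩
    · rw [← nhdsLT_sup_nhdsGT, eventually_sup]
      constructor
      · filter_upwards [self_mem_nhdsWithin,
          (h t).2.2.1.filter_mono (nhdsWithin_mono t fun s hs => ne_of_lt hs)] with s hs hs'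
        exact hs'.congr (hL s hs)
      · filter_upwards [self_mem_nhdsWithin,
          (h'' t).2.2.1.filter_mono (nhdsWithin_mono t fun s hs => ne_of_gt hs)] with s hs hs'
        exact hs'.congr (hR s hs)
  · exact (h'' t).congr (hR t ht)

/-- Orbits that extend each other up to times `T n` tending to infinity have a limit orbit. -/
theorem exists_orbit_of_eventually_stable (γ : ℕ → S.OrbitSpace) (T : ℕ → ℝ)
    (hT : Monotone T) (hlim : Tendsto T atTop atTop)
    (hγ : ∀ n, ∀ t ≤ T n, γ (n + 1) t = γ n t) :
    ∃ η : S.OrbitSpace, ∀ n, ∀ t ≤ T n, η t = γ n t := by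
  have hmn : ∀ n k, ∀ t ≤ T n, γ (n + k) t = γ n t := by
    intro n k
    induction k with
    | zero => intro t _; rfl
    | succ k ih =>
      intro t ht
      rw [← add_assoc, hγ _ t (ht.trans (hT (Nat.le_add_right n k))), ih t ht]
  choose N hN using fun t : ℝ => (hlim.eventually_ge_atTop t).exists
  have key : ∀ n, ∀ t ≤ T n, γ (N t) t = γ n t := by
    intro n t ht
    rcases le_total (N t) n with h | h
    · obtain ⟨k, rfl⟩ := Nat.exists_eq_add_of_le h
      exact (hmn _ k t (hN t)).symm
    · obtain ⟨k, hk⟩ := Nat.exists_eq_add_of_le h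
      rw [hk]
      exact hmn n k t ht
  refine ⟨⟨fun t => γ (N t) t, ?_⟩, key⟩
  rw [isOrbit_iff_forall_isOrbitNear]
  intro t
  refine (isOrbit_iff_forall_isOrbitNear.1 (γ (N (t + 1))).2 t).congr ?_
  filter_upwards [Iic_mem_nhds (lt_add_one t)] with s hs
  exact (key _ s (le_trans hs (hN (t + 1)))).symm

/-! ### Transitivity from a recurrent point of the discontinuity set -/

variable (S) in
/-- Curves that are uniformly close on a large compact interval are close for the distance of the
orbit space. -/
def OrbitDistControlled : Prop :=
  ∀ ε > 0, ∃ T : ℝ, ∃ δ > 0, ∀ γ γ' : S.OrbitSpace,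
    (∀ t ∈ Icc (-T) T, dist (γ t) (γ' t) ≤ δ) → S.orbitDist γ γ' < ε

/-- The witness follows `γ` until a visit to `p` after `T`, then `γ'` from a visit before `-T'`; it
agrees exactly with each of them on the interval that matters. -/
theorem isTopTransitiveFlow_of_recurs {p : E} (hp : p ∈ S.switchingSet)
    (hrec : S.EveryOrbitRecursThrough p) (hd : S.OrbitDistControlled) :
    IsTopTransitiveFlow S.flow := by
  rintro U V hU hV ⟨γ, hγ⟩ ⟨γ', hγ'⟩
  obtain ⟨ε, hε, hεU⟩ := hU γ hγ
  obtain ⟨ε', hε', hεV⟩ := hV γ' hγ'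
  obtain ⟨T, δ, hδ, h⟩ := hd ε hε
  obtain ⟨T', δ', hδ', h'⟩ := hd ε' hε'
  obtain ⟨a, ha, hap⟩ := (hrec γ (max T 0)).1
  obtain ⟨b, hb, hbp⟩ := (hrec γ' (min (-T') 0)).2
  rw [gt_iff_lt, max_lt_iff] at ha
  rw [lt_min_iff] at hb
  have hab : γ a = γ' b := hap.trans hbp.symm
  let η : S.OrbitSpace := ⟨concat γ γ' a b, γ.2.concat γ'.2 hab (hap ▸ hp)⟩
  refine ⟨a - b, by linarith, S.flow (a - b) η, ⟨η, hεU η (h γ η fun t ht => ?_), rfl⟩,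
    hεV _ (h' _ _ fun t ht => ?_)⟩
  · have : η t = γ t := concat_of_le (ht.2.trans ha.1.le)
    rw [this, dist_self]
    exact hδ.le
  · have : S.flow (a - b) η t = γ' t := by
      refine (concat_of_ge hab ?_).trans (congrArg γ' (by ring))
      linarith [ht.1]
    rw [this, dist_self]
    exact hδ'.le

/-- Orbits form a subspace of the second countable space `C(ℝ, E)`, so countably many `σ m` are
dense for uniform convergence on compacts. One orbit is built that reproduces each `σ m` on
arbitrarily long windows. -/
theorem isTransitiveFlow_of_recurs [SecondCountableTopology E] [Nonempty S.OrbitSpace] {p : E}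
    (hp : p ∈ S.switchingSet) (hrec : S.EveryOrbitRecursThrough p)
    (hd : S.OrbitDistControlled) : IsTransitiveFlow S.flow := by
  obtain ⟨γ₀⟩ := ‹Nonempty S.OrbitSpace›
  let ι : S.OrbitSpace → C(ℝ, E) := fun γ => ⟨γ, γ.2.1⟩
  have : Nonempty (range ι) := ⟨⟨ι γ₀, γ₀, rfl⟩⟩
  obtain ⟨u, hu⟩ := TopologicalSpace.exists_dense_seq (range ι)
  choose σ hσ using fun n => (u n).2
  -- The state is an orbit with a time at which it sits at `p`. Stage `n` keeps the past and appends
  -- a stretch of `σ n.unpair.1` containing its window `[-n, n]`; `c` is the resulting time shift.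
  have step : ∀ (n : ℕ) (x : {x : S.OrbitSpace × ℝ // x.1 x.2 = p}),
      ∃ y : {y : S.OrbitSpace × ℝ // y.1 y.2 = p}, x.1.2 + 1 ≤ y.1.2 ∧
        (∀ t ≤ x.1.2, y.1.1 t = x.1.1 t) ∧
        ∃ c : ℝ, c + n ≤ y.1.2 ∧
          ∀ t ∈ Icc (-(n : ℝ)) n, y.1.1 (c + t) = σ n.unpair.1 t := by
    rintro n ⟨⟨γ, a⟩, hx⟩
    have hx : γ a = p := hx
    -- The extra `-1` makes the appended stretch longer than `1` even for `n = 0`, so the marked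
    -- times tend to infinity.
    obtain ⟨b, hb, hbp⟩ := (hrec (σ n.unpair.1) (-(n : ℝ) - 1)).2
    obtain ⟨b', hb', hbp'⟩ := (hrec (σ n.unpair.1) (n : ℝ)).1
    have hab : γ a = σ n.unpair.1 b := hx.trans hbp.symm
    have hn : (0 : ℝ) ≤ n := n.cast_nonneg
    have hval : concat γ (σ n.unpair.1) a b (b' - b + a) = p := by
      refine (concat_of_ge hab (by linarith)).trans ?_
      rw [← hbp']
      exact congrArg (σ n.unpair.1) (by ring)
    refine ⟨⟨⟨⟨concat γ (σ n.unpair.1) a b, γ.2.concat (σ n.unpair.1).2 hab (hx ▸ hp)⟩,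
      b' - b + a⟩, hval⟩, ?_, fun t ht => concat_of_le ht, a - b, ?_, fun t ht => ?_⟩
    · show a + 1 ≤ b' - b + a
      linarith
    · show a - b + n ≤ b' - b + a
      linarith
    · refine (concat_of_ge hab ?_).trans (congrArg (σ n.unpair.1) (by ring))
      linarith [ht.1]
  choose next hn1 hn2 c hc hcσ using step
  obtain ⟨a₀, -, ha₀⟩ := (hrec γ₀ 0).1
  let x : ℕ → {x : S.OrbitSpace × ℝ // x.1 x.2 = p} := fun n =>
    Nat.rec ⟨(γ₀, a₀), ha₀⟩ next n
  have hxs : ∀ n, x (n + 1) = next n (x n) := fun n => rfl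
  have hT1 : ∀ n, (x n).1.2 + 1 ≤ (x (n + 1)).1.2 := fun n => by rw [hxs]; exact hn1 _ _
  have hTlim : Tendsto (fun n => (x n).1.2) atTop atTop := by
    have hlow : ∀ n : ℕ, a₀ + n ≤ (x n).1.2 := by
      intro n
      induction n with
      | zero => simp [x]
      | succ n ih => push_cast; linarith [hT1 n]
    exact tendsto_atTop_mono hlow (tendsto_atTop_add_const_left _ _ tendsto_natCast_atTop_atTop)
  obtain ⟨η, hη⟩ := exists_orbit_of_eventually_stable (fun n => (x n).1.1) (fun n => (x n).1.2)
    (monotone_nat_of_le_succ fun n => by linarith [hT1 n]) hTlim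
    (fun n t ht => by simp only [hxs]; exact hn2 _ _ t ht)
  refine ⟨η, ?_⟩
  rw [dense_iff_inter_open]
  rintro U hU ⟨γ, hγ⟩
  obtain ⟨ε, hε, hεU⟩ := hU γ hγ
  obtain ⟨T, δ, hδ, h⟩ := hd ε hε
  have hK : IsCompact (Icc (-T) T) := isCompact_Icc
  have hnear : ∀ᶠ f : range ι in 𝓝 ⟨ι γ, γ, rfl⟩, ∀ t ∈ Icc (-T) T, dist (γ t) (f.1 t) < δ := by
    have h1 := (ContinuousMap.tendsto_iff_forall_isCompact_tendstoUniformlyOn.1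
      (continuous_subtype_val.tendsto (⟨ι γ, γ, rfl⟩ : range ι))) _ hK
    exact Metric.tendstoUniformlyOn_iff.1 h1 δ hδ
  obtain ⟨_, ⟨m, rfl⟩, hm⟩ := hu.inter_nhds_nonempty hnear
  obtain ⟨k, hk⟩ := exists_nat_ge T
  -- Stage `Nat.pair m k` treats `σ m` and has index at least `k ≥ T`, so its window covers `[-T,
  -- T]`.
  set n := Nat.pair m k with hndef
  have hkn : (k : ℝ) ≤ n := by exact_mod_cast Nat.right_le_pair m k
  refine ⟨S.flow (c n (x n)) η, hεU _ (h _ _ fun t ht => ?_), _, rfl⟩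
  have htn : t ∈ Icc (-(n : ℝ)) n := ⟨by linarith [ht.1], by linarith [ht.2]⟩
  have e1 : S.flow (c n (x n)) η t = σ m t := by
    show η (c n (x n) + t) = σ m t
    rw [hη (n + 1) _ (by simp only [hxs]; linarith [hc n (x n), htn.2])]
    simp only [hxs]
    rw [hcσ n (x n) t htn, hndef, Nat.unpair_pair]
  have e2 : (u m).1 t = σ m t := by rw [← hσ m]; rfl
  rw [e1, ← e2]
  exact (hm t ht).le

end FilippovSystem

/-! ### Control of the integral distance -/

namespace FilippovSystem

variable {E : Type*} [NormedAddCommGroup E] [NormedSpace ℝ E] {S : FilippovSystem E}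

theorem pathDist_le_of_lipschitzOnWith {p q : E} {c : ℝ → E} {K : NNReal}
    (hK : LipschitzOnWith K c (Icc 0 1)) (hc : MapsTo c (Icc 0 1) S.carrier) (h0 : c 0 = p)
    (h1 : c 1 = q) : S.pathDist p q ≤ K := by
  have h2 : eVariationOn c (Icc 0 1) ≤ K := by
    have := hK.comp_eVariationOn_le (g := id) (mapsTo_id (Icc (0 : ℝ) 1))
    simpa using this
  refine ENNReal.toReal_le_of_le_ofReal K.2 ?_
  rw [ENNReal.ofReal_coe_nnreal]
  exact (iInf₂_le_of_le c hK.continuousOn (iInf₂_le_of_le hc h0 (iInf_le _ h1))).trans h2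

theorem summable_one_div_two_pow_natAbs : Summable fun i : ℤ => (1 : ℝ) / 2 ^ i.natAbs := by
  refine Summable.of_nat_of_neg ?_ ?_ <;> simpa using summable_geometric_two

theorem pathDist_nonneg (p q : E) : 0 ≤ S.pathDist p q := ENNReal.toReal_nonneg

/-- Outside a finite set `s` of indices the weights have small sum, and the bound `D` suffices; on
`s` the closeness of the curves is used through `C`. Each part contributes at most `ε / 2`, the tail
strictly less. -/
theorem orbitDistControlled_of_pathDist_le {C D : ℝ}
    (hC : ∀ p ∈ S.carrier, ∀ q ∈ S.carrier, S.pathDist p q ≤ C * dist p q)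
    (hD : ∀ p ∈ S.carrier, ∀ q ∈ S.carrier, S.pathDist p q ≤ D) : S.OrbitDistControlled := by
  intro ε hε
  set w : ℤ → ℝ := fun i => 1 / 2 ^ i.natAbs with hw
  have hws : Summable w := summable_one_div_two_pow_natAbs
  have hw0 : ∀ i, 0 < w i := fun i => by positivity
  have hC' : 0 < max C 1 := lt_max_of_lt_right one_pos
  have hD' : 0 < max D 1 := lt_max_of_lt_right one_pos
  have hW : 0 < ∑' i, w i := hws.tsum_pos (fun i => (hw0 i).le) 0 (hw0 0)
  obtain ⟨s, hs⟩ := ((tendsto_order.1 (tendsto_tsum_compl_atTop_zero w)).2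
    (ε / (2 * max D 1)) (by positivity)).exists
  have hs' : ∑' i, ({i | i ∉ s} : Set ℤ).indicator w i < ε / (2 * max D 1) := by
    rw [← tsum_subtype]
    exact hs
  set v : ℤ → ℝ := ({i | i ∉ s} : Set ℤ).indicator w with hv
  have hvs : Summable v := hws.indicator _
  set δ := ε / (2 * (max C 1 * ∑' i, w i)) with hδ
  have hδ0 : 0 < δ := by positivity
  -- The `+ 1` ensures `[i, i + 1] ⊆ [-T, T]` for every `i ∈ s`.
  refine ⟨(s.sup Int.natAbs : ℕ) + 1, δ, hδ0, fun γ γ' h => ?_⟩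
  have hterm : ∀ i : ℤ, ‖w i * ∫ t in (i : ℝ)..(i + 1), S.pathDist (γ t) (γ' t)‖
      ≤ max C 1 * δ * w i + max D 1 * v i := by
    intro i
    have hint : ∀ b : ℝ, (∀ t ∈ Icc (i : ℝ) (i + 1), S.pathDist (γ t) (γ' t) ≤ b) →
        ‖∫ t in (i : ℝ)..(i + 1), S.pathDist (γ t) (γ' t)‖ ≤ b := by
      intro b hb
      -- This bound requires no measurability of the path distance along the orbits.
      have := intervalIntegral.norm_integral_le_of_norm_le_const (a := (i : ℝ)) (b := i + 1)
        (f := fun t => S.pathDist (γ t) (γ' t)) (C := b) fun t ht => by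
          rw [uIoc_of_le (by linarith)] at ht
          rw [Real.norm_of_nonneg (pathDist_nonneg _ _)]
          exact hb t ⟨ht.1.le, ht.2⟩
      simpa using this
    rw [norm_mul, Real.norm_of_nonneg (hw0 i).le]
    by_cases hi : i ∈ s
    · have hvi : v i = 0 := indicator_of_notMem (s := {i | i ∉ s}) (not_not.2 hi) w
      have hle : i.natAbs ≤ s.sup Int.natAbs := Finset.le_sup (f := Int.natAbs) hi
      have hle' : |(i : ℝ)| ≤ (s.sup Int.natAbs : ℕ) := by
        rw [← Int.cast_abs, ← Int.natCast_natAbs]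
        exact_mod_cast hle
      rw [abs_le] at hle'
      have := hint (max C 1 * δ) fun t ht => by
        have h1 := h t ⟨by linarith [ht.1], by linarith [ht.2]⟩
        calc S.pathDist (γ t) (γ' t) ≤ C * dist (γ t) (γ' t) :=
              hC _ (γ.2.2.1 t) _ (γ'.2.2.1 t)
          _ ≤ max C 1 * δ := mul_le_mul (le_max_left _ _) h1 dist_nonneg hC'.le
      rw [hvi]
      nlinarith [hw0 i]
    · have hvi : v i = w i := indicator_of_mem (s := {i | i ∉ s}) hi w
      have := hint (max D 1) fun t _ =>
        (hD _ (γ.2.2.1 t) _ (γ'.2.2.1 t)).trans (le_max_left _ _)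
      rw [hvi]
      have h3 : 0 ≤ max C 1 * δ * w i := mul_nonneg (mul_nonneg hC'.le hδ0.le) (hw0 i).le
      nlinarith [hw0 i]
  have hle : S.orbitDist γ γ' ≤ ∑' i, (max C 1 * δ * w i + max D 1 * v i) :=
    (le_abs_self _).trans (tsum_of_norm_bounded
      ((hws.mul_left _).add (hvs.mul_left _)).hasSum hterm)
  rw [(hws.mul_left _).tsum_add (hvs.mul_left _), tsum_mul_left, tsum_mul_left] at hle
  have h1 : max C 1 * δ * ∑' i, w i = ε / 2 := by
    rw [hδ]
    field_simp
  have h2 : max D 1 * ∑' i, v i < ε / 2 := by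
    rw [lt_div_iff₀ (by positivity)] at hs'
    linarith
  linarith

end FilippovSystem

/-! ### The intrinsic distance of the bean -/

theorem bean_lower_lipschitz {a b : ℝ} (ha : a ∈ Icc (-1 : ℝ) 1) (hb : b ∈ Icc (-1 : ℝ) 1) :
    |(a ^ 4 / 2 - a ^ 2 / 2) - (b ^ 4 / 2 - b ^ 2 / 2)| ≤ 2 * |a - b| := by
  have h : (a ^ 4 / 2 - a ^ 2 / 2) - (b ^ 4 / 2 - b ^ 2 / 2)
      = ((a + b) * (a ^ 2 + b ^ 2 - 1) / 2) * (a - b) := by ring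
  have h1 : |a + b| ≤ 2 := abs_le.2 ⟨by linarith [ha.1, hb.1], by linarith [ha.2, hb.2]⟩
  have h2 : |a ^ 2 + b ^ 2 - 1| ≤ 1 :=
    abs_le.2 ⟨by nlinarith, by nlinarith [ha.1, ha.2, hb.1, hb.2]⟩
  rw [h, abs_mul]
  gcongr
  rw [abs_div, abs_mul, abs_two]
  nlinarith [abs_nonneg (a + b), abs_nonneg (a ^ 2 + b ^ 2 - 1)]

theorem bean_upper_lipschitz {a b : ℝ} (ha : a ∈ Icc (-1 : ℝ) 1) (hb : b ∈ Icc (-1 : ℝ) 1) :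
    |(1 - a ^ 2) - (1 - b ^ 2)| ≤ 2 * |a - b| := by
  have h : (1 - a ^ 2) - (1 - b ^ 2) = (-(a + b)) * (a - b) := by ring
  have h1 : |a + b| ≤ 2 := abs_le.2 ⟨by linarith [ha.1, hb.1], by linarith [ha.2, hb.2]⟩
  rw [h, abs_mul, abs_neg]
  gcongr

theorem EuclideanSpace.dist_le_abs_add_abs (p q : EuclideanSpace ℝ (Fin 2)) :
    dist p q ≤ |p 0 - q 0| + |p 1 - q 1| := by
  rw [EuclideanSpace.dist_eq, Fin.sum_univ_two, Real.sqrt_le_iff]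
  refine ⟨by positivity, ?_⟩
  rw [Real.dist_eq, Real.dist_eq]
  nlinarith [abs_nonneg (p 0 - q 0), abs_nonneg (p 1 - q 1)]

theorem EuclideanSpace.abs_sub_le_dist (p q : EuclideanSpace ℝ (Fin 2)) (i : Fin 2) :
    |p i - q i| ≤ dist p q := by
  rw [dist_eq_norm]
  exact PiLp.norm_apply_le (p - q) i

/-- The segment from `p` to `q` may leave the bean; clamping its height between the two boundary
graphs, both 2-Lipschitz, gives a Lipschitz curve inside with the same endpoints. -/
theorem bean_pathDist_le {p q : EuclideanSpace ℝ (Fin 2)} (hp : p ∈ beanRegion)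
    (hq : q ∈ beanRegion) :
    beanSystem.pathDist p q ≤ 3 * |p 0 - q 0| + |p 1 - q 1| := by
  set L : ℝ → ℝ := fun x => x ^ 4 / 2 - x ^ 2 / 2 with hL
  set U : ℝ → ℝ := fun x => 1 - x ^ 2 with hU
  set X : ℝ → ℝ := fun s => p 0 + s * (q 0 - p 0) with hX
  set Y : ℝ → ℝ := fun s => p 1 + s * (q 1 - p 1) with hY
  obtain ⟨hp1, hp2, hp3, hp4⟩ := hp
  obtain ⟨hq1, hq2, hq3, hq4⟩ := hq
  have hXm : ∀ s ∈ Icc (0 : ℝ) 1, X s ∈ Icc (-1 : ℝ) 1 := by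
    rintro s ⟨h0, h1⟩
    constructor <;> simp only [hX] <;> nlinarith
  have hX' : ∀ s t, |X s - X t| = |p 0 - q 0| * |s - t| := fun s t => by
    rw [← abs_mul, ← abs_neg]; congr 1; simp only [hX]; ring
  have hY' : ∀ s t, |Y s - Y t| = |p 1 - q 1| * |s - t| := fun s t => by
    rw [← abs_mul, ← abs_neg]; congr 1; simp only [hY]; ring
  have hK : 0 ≤ 3 * |p 0 - q 0| + |p 1 - q 1| := by positivity
  refine FilippovSystem.pathDist_le_of_lipschitzOnWith (K := ⟨_, hK⟩)
    (c := fun s => !₂[X s, max (L (X s)) (min (U (X s)) (Y s))]) ?_ ?_ ?_ ?_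
  · refine LipschitzOnWith.of_dist_le_mul fun s hs t ht => ?_
    refine (EuclideanSpace.dist_le_abs_add_abs _ _).trans ?_
    have h1 := bean_lower_lipschitz (hXm s hs) (hXm t ht)
    have h2 := bean_upper_lipschitz (hXm s hs) (hXm t ht)
    have h3 := abs_max_sub_max_le_max (L (X s)) (min (U (X s)) (Y s)) (L (X t))
      (min (U (X t)) (Y t))
    have h4 := abs_min_sub_min_le_max (U (X s)) (Y s) (U (X t)) (Y t)
    have h5 : 0 ≤ |p 0 - q 0| * |s - t| := by positivity
    have h6 : 0 ≤ |p 1 - q 1| * |s - t| := by positivity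
    rw [hX'] at h1 h2
    rw [hY'] at h4
    have h7 : |max (L (X s)) (min (U (X s)) (Y s)) - max (L (X t)) (min (U (X t)) (Y t))|
        ≤ 2 * (|p 0 - q 0| * |s - t|) + |p 1 - q 1| * |s - t| := by
      refine h3.trans (max_le (by linarith) (h4.trans (max_le (by linarith) (by linarith))))
    show |X s - X t| + |max (L (X s)) (min (U (X s)) (Y s)) - max (L (X t)) (min (U (X t)) (Y t))|
      ≤ (3 * |p 0 - q 0| + |p 1 - q 1|) * dist s t
    rw [hX', Real.dist_eq]
    linarith
  · intro s hs
    have hx := hXm s hs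
    have h1 : L (X s) ≤ U (X s) := by
      simp only [hL, hU]
      nlinarith [mul_nonneg (sub_nonneg.2 hx.2) (neg_le_iff_add_nonneg.1 hx.1), sq_nonneg (X s)]
    exact ⟨hx.1, hx.2, le_max_left _ _, max_le h1 (min_le_left _ _)⟩
  · ext i
    fin_cases i
    · simp [hX]
    · simp [hX, hY, hL, hU, hp3, hp4]
  · ext i
    fin_cases i
    · simp [hX]
    · simp [hX, hY, hL, hU, hq3, hq4]

theorem bean_orbitDistControlled : beanSystem.OrbitDistControlled := by
  refine FilippovSystem.orbitDistControlled_of_pathDist_le (C := 4) (D := 9)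
    (fun p hp q hq => ?_) fun p hp q hq => ?_
  · refine (bean_pathDist_le hp hq).trans ?_
    linarith [EuclideanSpace.abs_sub_le_dist p q 0, EuclideanSpace.abs_sub_le_dist p q 1]
  · refine (bean_pathDist_le hp hq).trans ?_
    obtain ⟨hp1, hp2, hp3, hp4⟩ := hp
    obtain ⟨hq1, hq2, hq3, hq4⟩ := hq
    have h1 : |p 0 - q 0| ≤ 2 := abs_le.2 ⟨by linarith, by linarith⟩
    have h2 : |p 1 - q 1| ≤ 3 := by
      refine abs_le.2 ⟨?_, ?_⟩ <;> nlinarith [sq_nonneg (p 0), sq_nonneg (q 0),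
        sq_nonneg (p 0 ^ 2 - 1), sq_nonneg (q 0 ^ 2 - 1)]
    linarith

/-! ### Recurrence through the origin -/

theorem le_sub_mul_of_hasDerivAt_le_off_finite {f : ℝ → ℝ} {c : ℝ} (B : Finset ℝ) {a b : ℝ}
    (hab : a ≤ b) (hf : ContinuousOn f (Icc a b))
    (hd : ∀ t ∈ Ioo a b, t ∉ B → ∃ f', HasDerivAt f f' t ∧ f' ≤ -c) :
    f b ≤ f a - c * (b - a) := by
  induction B using Finset.induction generalizing a b with
  | empty =>
    have hd' : ∀ t ∈ interior (Icc a b), ∃ f', HasDerivAt f f' t ∧ f' ≤ -c := fun t ht =>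
      hd t (by rwa [interior_Icc] at ht) (Finset.notMem_empty t)
    have := (convex_Icc a b).image_sub_le_mul_sub_of_deriv_le hf
      (fun t ht => (hd' t ht).choose_spec.1.differentiableAt.differentiableWithinAt)
      (C := -c) (fun t ht => by
        rw [(hd' t ht).choose_spec.1.deriv]; exact (hd' t ht).choose_spec.2)
      a (left_mem_Icc.2 hab) b (right_mem_Icc.2 hab) hab
    linarith
  | insert u B _ ih =>
    by_cases hu : u ∈ Ioo a b
    · have h1 := ih hu.1.le (hf.mono (Icc_subset_Icc_right hu.2.le)) fun t ht htB =>
        hd t ⟨ht.1, ht.2.trans hu.2⟩ (by simp [htB, ht.2.ne])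
      have h2 := ih hu.2.le (hf.mono (Icc_subset_Icc_left hu.1.le)) fun t ht htB =>
        hd t ⟨hu.1.trans ht.1, ht.2⟩ (by simp [htB, ht.1.ne'])
      linarith
    · exact ih hab hf fun t ht htB => hd t ht (by
        rw [Finset.mem_insert, not_or]
        exact ⟨fun h => hu (h ▸ ht), htB⟩)

theorem bean_fderiv_h (p : EuclideanSpace ℝ (Fin 2)) :
    fderiv ℝ beanSystem.h p = EuclideanSpace.proj (1 : Fin 2) :=
  (EuclideanSpace.proj (1 : Fin 2) : EuclideanSpace ℝ (Fin 2) →L[ℝ] ℝ).hasFDerivAt.fderiv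

theorem bean_lieDerivPos (p : EuclideanSpace ℝ (Fin 2)) :
    beanSystem.lieDerivPos p = -2 * p 0 := by
  rw [FilippovSystem.lieDerivPos, bean_fderiv_h]
  simp [beanSystem]

theorem bean_lieDerivNeg (p : EuclideanSpace ℝ (Fin 2)) :
    beanSystem.lieDerivNeg p = 2 * p 0 - 4 * p 0 ^ 3 := by
  rw [FilippovSystem.lieDerivNeg, bean_fderiv_h]
  simp [beanSystem]

theorem bean_slidingField_apply_zero (p : EuclideanSpace ℝ (Fin 2)) :
    beanSystem.slidingField p 0 =
      (4 * p 0 - 4 * p 0 ^ 3)⁻¹ * (-2 * p 0 - 4 * p 0 ^ 3) := by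
  rw [FilippovSystem.slidingField, bean_lieDerivPos, bean_lieDerivNeg]
  simp [beanSystem]
  ring

theorem bean_mem_slidingSet {p : EuclideanSpace ℝ (Fin 2)} (hp : p ∈ beanSystem.slidingSet) :
    p 1 = 0 ∧ p 0 ≠ 0 ∧ p 0 ^ 2 < 1 / 2 := by
  obtain ⟨⟨-, h0⟩, h1⟩ := hp
  rw [bean_lieDerivPos, bean_lieDerivNeg] at h1
  have h2 : p 0 ≠ 0 := by
    intro h
    simp [h] at h1
  refine ⟨h0, h2, ?_⟩
  have h3 : 0 < p 0 ^ 2 := by positivity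
  by_contra! h
  nlinarith

theorem hasDerivAt_apply {γ : ℝ → EuclideanSpace ℝ (Fin 2)} {v : EuclideanSpace ℝ (Fin 2)} {t : ℝ}
    (h : HasDerivAt γ v t) (i : Fin 2) : HasDerivAt (fun s => γ s i) (v i) t :=
  (EuclideanSpace.proj i : EuclideanSpace ℝ (Fin 2) →L[ℝ] ℝ).hasFDerivAt.comp_hasDerivAt
    t h

/-- A function that decreases along all orbits of the bean model that avoid the origin. -/
noncomputable def beanLyapunov (p : EuclideanSpace ℝ (Fin 2)) : ℝ :=
  p 0 - 2 * (p 0 / √(p 0 ^ 2 + max (p 1) 0))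

/-- The lower boundary touches height `0` at `x = 0`, so the bean has no point with `x = 0` and `y <
0`. -/
theorem bean_sq_add_max_pos {p : EuclideanSpace ℝ (Fin 2)} (hp : p ∈ beanRegion)
    (h0 : p ≠ !₂[0, 0]) : 0 < p 0 ^ 2 + max (p 1) 0 := by
  obtain ⟨-, -, h3, -⟩ := hp
  have h4 := le_max_right (p 1) 0
  have h5 := le_max_left (p 1) 0
  by_contra! h
  have h6 : p 0 = 0 := by nlinarith [sq_nonneg (p 0)]
  apply h0
  ext i
  fin_cases i
  · simpa using h6
  · have : p 1 = 0 := by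
      simp only [h6] at h3 h
      linarith
    simpa using this

theorem bean_continuousAt_lyapunov {p : EuclideanSpace ℝ (Fin 2)} (hp : p ∈ beanRegion)
    (h0 : p ≠ !₂[0, 0]) : ContinuousAt beanLyapunov p := by
  have h := (Real.sqrt_pos.2 (bean_sq_add_max_pos hp h0)).ne'
  have c0 : Continuous fun p : EuclideanSpace ℝ (Fin 2) => p 0 := by fun_prop
  have c1 : Continuous fun p : EuclideanSpace ℝ (Fin 2) => p 1 := by fun_prop
  exact c0.continuousAt.sub (continuousAt_const.mul (c0.continuousAt.div
    (((c0.pow 2).add (c1.max continuous_const)).sqrt).continuousAt h))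

theorem bean_abs_lyapunov_le {p : EuclideanSpace ℝ (Fin 2)} (hp : p ∈ beanRegion) :
    |beanLyapunov p| ≤ 3 := by
  have h1 : |p 0| ≤ 1 := abs_le.2 ⟨hp.1, hp.2.1⟩
  have h2 : |p 0 / √(p 0 ^ 2 + max (p 1) 0)| ≤ 1 := by
    rw [abs_div, abs_of_nonneg (Real.sqrt_nonneg _)]
    refine div_le_one_of_le₀ (Real.abs_le_sqrt ?_) (Real.sqrt_nonneg _)
    linarith [le_max_right (p 1) 0]
  rw [abs_le] at h1 h2 ⊢
  unfold beanLyapunov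
  constructor <;> linarith [h1.1, h1.2, h2.1, h2.2]

theorem bean_hasDerivAt_lyapunov_of_nonpos {γ : ℝ → EuclideanSpace ℝ (Fin 2)} {t u : ℝ}
    (hx : HasDerivAt (fun s => γ s 0) u t) (h0 : γ t 0 ≠ 0) (hy : ∀ᶠ s in 𝓝 t, γ s 1 ≤ 0) :
    HasDerivAt (fun s => beanLyapunov (γ s)) u t := by
  rcases lt_or_gt_of_ne h0 with h | h
  · refine (hx.add_const 2).congr_of_eventuallyEq ?_
    filter_upwards [hy, hx.continuousAt.eventually_lt_const h] with s hs hs'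
    rw [beanLyapunov, max_eq_right hs, add_zero, Real.sqrt_sq_eq_abs, abs_of_neg hs', div_neg,
      div_self hs'.ne]
    ring
  · refine (hx.sub_const 2).congr_of_eventuallyEq ?_
    filter_upwards [hy, hx.continuousAt.eventually_const_lt h] with s hs hs'
    rw [beanLyapunov, max_eq_right hs, add_zero, Real.sqrt_sq_eq_abs, abs_of_pos hs',
      div_self hs'.ne']
    ring

theorem bean_hasDerivAt_lyapunov_of_pos {γ : ℝ → EuclideanSpace ℝ (Fin 2)} {t : ℝ}
    (hx : HasDerivAt (fun s => γ s 0) 1 t) (hy : HasDerivAt (fun s => γ s 1) (-2 * γ t 0) t)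
    (h : 0 < γ t 1) :
    HasDerivAt (fun s => beanLyapunov (γ s)) (1 - 2 * (1 / √(γ t 0 ^ 2 + γ t 1))) t := by
  have hc : 0 < γ t 0 ^ 2 + γ t 1 := by positivity
  -- `x² + y` is a first integral of `Z₊`, so the square root in the denominator has zero
  -- derivative.
  have h1 : HasDerivAt (fun s => γ s 0 ^ 2 + γ s 1) 0 t := by
    refine ((hx.fun_pow 2).add hy).congr_deriv ?_
    push_cast
    ring
  have h2 := hx.sub ((hx.div (h1.sqrt hc.ne') (Real.sqrt_pos.2 hc).ne').const_mul 2)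
  refine (h2.congr_of_eventuallyEq ?_).congr_deriv ?_
  · filter_upwards [hy.continuousAt.eventually_const_lt h] with s hs
    simp [beanLyapunov, max_eq_left (le_of_lt hs)]
  · have h3 := Real.sqrt_pos.2 hc
    field_simp
    ring

theorem bean_lyapunov_decreases {γ : ℝ → EuclideanSpace ℝ (Fin 2)} {t : ℝ}
    (h : beanSystem.IsSmoothPieceAt γ t) :
    ∃ f', HasDerivAt (fun s => beanLyapunov (γ s)) f' t ∧ f' ≤ -(1 / 2) := by
  obtain ⟨ε, hε, h⟩ := h
  have hnhds : Ioo (t - ε) (t + ε) ∈ 𝓝 t := Ioo_mem_nhds (by linarith) (by linarith)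
  have ht : t ∈ Ioo (t - ε) (t + ε) := ⟨by linarith, by linarith⟩
  rcases h with h | h | h
  · obtain ⟨⟨hm, hpos⟩, hd⟩ := h t ht
    have hpos : 0 < γ t 1 := hpos
    refine ⟨_, bean_hasDerivAt_lyapunov_of_pos (hasDerivAt_apply hd 0) (hasDerivAt_apply hd 1)
      hpos, ?_⟩
    have hc : 0 < γ t 0 ^ 2 + γ t 1 := by positivity
    have h1 : √(γ t 0 ^ 2 + γ t 1) ≤ 1 := Real.sqrt_le_one.2 (by linarith [hm.2.2.2])
    have h2 := one_le_one_div (Real.sqrt_pos.2 hc) h1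
    linarith
  · obtain ⟨⟨hm, hneg⟩, hd⟩ := h t ht
    have hneg : γ t 1 < 0 := hneg
    refine ⟨_, bean_hasDerivAt_lyapunov_of_nonpos (hasDerivAt_apply hd 0) (fun h0 => ?_) ?_,
      ?_⟩
    · have := hm.2.2.1
      rw [h0] at this
      linarith
    · filter_upwards [hnhds] with s hs
      exact (h s hs).1.2.le
    · show (-2 : ℝ) ≤ -(1 / 2)
      norm_num
  · obtain ⟨hm, hd⟩ := h t ht
    obtain ⟨-, h0, hlt⟩ := bean_mem_slidingSet hm
    refine ⟨_, bean_hasDerivAt_lyapunov_of_nonpos (hasDerivAt_apply hd 0) h0 ?_, ?_⟩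
    · filter_upwards [hnhds] with s hs
      exact (bean_mem_slidingSet (h s hs).1).1.le
    · rw [bean_slidingField_apply_zero]
      set x := γ t 0
      have h1 : 0 < 1 - x ^ 2 := by linarith
      -- The sliding speed tends to `-1/2` as `x → 0`, which is where the rate `1/2` comes from.
      have h2 : (4 * x - 4 * x ^ 3)⁻¹ * (-2 * x - 4 * x ^ 3) =
          -((1 + 2 * x ^ 2) / (2 * (1 - x ^ 2))) := by
        have : (4 * x - 4 * x ^ 3) = 4 * x * (1 - x ^ 2) := by ring
        rw [this]
        field_simp
        ring
      rw [h2, neg_le_neg_iff, div_le_div_iff₀ (by norm_num) (by linarith)]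
      nlinarith [sq_nonneg x]

/-- At rate `1/2` the Lyapunov function would drop by `13/2` in time `13`, yet its values lie in
`[-3, 3]`. -/
theorem bean_exists_eq_zero (γ : beanSystem.OrbitSpace) (τ : ℝ) :
    ∃ t ∈ Icc τ (τ + 13), γ t = !₂[0, 0] := by
  by_contra! h
  obtain ⟨hc, hm, B, hB, -, hsm⟩ := γ.2
  have h1 := le_sub_mul_of_hasDerivAt_le_off_finite (f := fun s => beanLyapunov (γ s))
    (c := 1 / 2) (hB τ (τ + 13)).toFinset (a := τ) (b := τ + 13) (by linarith)
    (fun t ht => ((bean_continuousAt_lyapunov (hm t) (h t ht)).comp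
      hc.continuousAt).continuousWithinAt)
    (fun t ht htB => bean_lyapunov_decreases (hsm t fun h => htB (by
      rw [Set.Finite.mem_toFinset]
      exact ⟨h, ht.1.le, ht.2.le⟩)))
  have h2 := abs_le.1 (bean_abs_lyapunov_le (hm τ))
  have h3 := abs_le.1 (bean_abs_lyapunov_le (hm (τ + 13)))
  linarith [h2.2, h3.1]

theorem bean_everyOrbitRecursThrough_zero : beanSystem.EveryOrbitRecursThrough !₂[0, 0] := by
  intro γ τ
  obtain ⟨t, ht, h⟩ := bean_exists_eq_zero γ (τ + 1)
  obtain ⟨t', ht', h'⟩ := bean_exists_eq_zero γ (τ - 14)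
  exact ⟨⟨t, by linarith [ht.1], h⟩, ⟨t', by linarith [ht'.2], h'⟩⟩

/-! ### The periodic boundary orbit -/

/-- The integral curve of `Z₋` along the lower boundary of the bean. -/
noncomputable def beanLowerCurve (s : ℝ) : EuclideanSpace ℝ (Fin 2) :=
  !₂[1 - 2 * s, (1 - 2 * s) ^ 4 / 2 - (1 - 2 * s) ^ 2 / 2]

/-- The integral curve of `Z₊` along the upper boundary of the bean. -/
noncomputable def beanUpperCurve (s : ℝ) : EuclideanSpace ℝ (Fin 2) :=
  !₂[s - 2, 1 - (s - 2) ^ 2]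

/-- The curve that runs once along the boundary of the bean while its parameter runs through the
unit interval. -/
noncomputable def beanBoundaryLoop (v : ℝ) : EuclideanSpace ℝ (Fin 2) :=
  if v ≤ 1 / 3 then beanLowerCurve (3 * v) else beanUpperCurve (3 * v)

theorem hasDerivAt_vec_two {f g : ℝ → ℝ} {f' g' t : ℝ} (hf : HasDerivAt f f' t)
    (hg : HasDerivAt g g' t) :
    HasDerivAt (fun s => (!₂[f s, g s] : EuclideanSpace ℝ (Fin 2))) !₂[f', g'] t := by
  have h : HasDerivAt (fun s => ![f s, g s]) ![f', g'] t := by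
    rw [hasDerivAt_pi]
    intro i
    fin_cases i
    · exact hf
    · exact hg
  exact (PiLp.hasFDerivAt_toLp (𝕜 := ℝ) 2 _).comp_hasDerivAt t h

theorem beanLowerCurve_hasDerivAt (s : ℝ) :
    HasDerivAt beanLowerCurve (beanSystem.Zneg (beanLowerCurve s)) s := by
  have hx : HasDerivAt (fun s : ℝ => 1 - 2 * s) (-2) s := by
    simpa using ((hasDerivAt_id s).const_mul 2).const_sub 1
  have hy := ((hx.fun_pow 4).div_const 2).sub ((hx.fun_pow 2).div_const 2)
  refine (hasDerivAt_vec_two hx hy).congr_deriv ?_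
  ext i
  fin_cases i
  · simp [beanSystem]
  · simp [beanSystem, beanLowerCurve]
    ring

theorem beanUpperCurve_hasDerivAt (s : ℝ) :
    HasDerivAt beanUpperCurve (beanSystem.Zpos (beanUpperCurve s)) s := by
  have hx : HasDerivAt (fun s : ℝ => s - 2) 1 s := (hasDerivAt_id s).sub_const 2
  refine (hasDerivAt_vec_two hx ((hx.fun_pow 2).const_sub 1)).congr_deriv ?_
  ext i
  fin_cases i
  · simp [beanSystem]
  · simp [beanSystem, beanUpperCurve]

theorem beanLowerCurve_mem {s : ℝ} (hs : s ∈ Icc (0 : ℝ) 1) : beanLowerCurve s ∈ beanRegion := by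
  obtain ⟨h0, h1⟩ := hs
  refine ⟨?_, ?_, ?_, ?_⟩ <;> simp [beanLowerCurve]
  · linarith
  · linarith
  · nlinarith [sq_nonneg ((1 - 2 * s) ^ 2), mul_nonneg h0 (sub_nonneg.2 h1)]

theorem beanUpperCurve_mem {s : ℝ} (hs : s ∈ Icc (1 : ℝ) 3) : beanUpperCurve s ∈ beanRegion := by
  obtain ⟨h0, h1⟩ := hs
  refine ⟨?_, ?_, ?_, ?_⟩ <;> simp [beanUpperCurve]
  · linarith
  · linarith
  · nlinarith [sq_nonneg (s - 2), mul_nonneg (sub_nonneg.2 h0) (sub_nonneg.2 h1)]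

theorem beanLowerCurve_isSmoothPieceAt {s : ℝ} (hs : s ∈ Ioo (0 : ℝ) 1) (h : s ≠ 1 / 2) :
    beanSystem.IsSmoothPieceAt beanLowerCurve s := by
  have hev : ∀ᶠ r in 𝓝 s, r ∈ Ioo (0 : ℝ) 1 ∧ r ≠ 1 / 2 :=
    Filter.inter_mem (Ioo_mem_nhds hs.1 hs.2) (isOpen_ne.mem_nhds h)
  obtain ⟨ε, hε, hb⟩ := Metric.eventually_nhds_iff_ball.1 hev
  rw [Real.ball_eq_Ioo] at hb
  refine ⟨ε, hε, Or.inr (Or.inl fun r hr => ⟨⟨?_, ?_⟩, beanLowerCurve_hasDerivAt r⟩)⟩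
  · exact beanLowerCurve_mem ⟨(hb r hr).1.1.le, (hb r hr).1.2.le⟩
  · obtain ⟨⟨h0, h1⟩, h2⟩ := hb r hr
    show (1 - 2 * r) ^ 4 / 2 - (1 - 2 * r) ^ 2 / 2 < 0
    have h3 : 0 < (1 - 2 * r) ^ 2 := by
      have : 1 - 2 * r ≠ 0 := fun h => h2 (by linarith)
      positivity
    have h4 : (1 - 2 * r) ^ 2 < 1 := by nlinarith
    nlinarith

theorem beanUpperCurve_isSmoothPieceAt {s : ℝ} (hs : s ∈ Ioo (1 : ℝ) 3) :
    beanSystem.IsSmoothPieceAt beanUpperCurve s := by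
  have hev : ∀ᶠ r in 𝓝 s, r ∈ Ioo (1 : ℝ) 3 := Ioo_mem_nhds hs.1 hs.2
  obtain ⟨ε, hε, hb⟩ := Metric.eventually_nhds_iff_ball.1 hev
  rw [Real.ball_eq_Ioo] at hb
  refine ⟨ε, hε, Or.inl fun r hr => ⟨⟨?_, ?_⟩, beanUpperCurve_hasDerivAt r⟩⟩
  · exact beanUpperCurve_mem ⟨(hb r hr).1.le, (hb r hr).2.le⟩
  · obtain ⟨h0, h1⟩ := hb r hr
    show 0 < 1 - (r - 2) ^ 2
    nlinarith

theorem beanBoundaryLoop_continuous : Continuous beanBoundaryLoop := by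
  have h1 : Continuous beanLowerCurve :=
    continuous_iff_continuousAt.2 fun s => (beanLowerCurve_hasDerivAt s).continuousAt
  have h2 : Continuous beanUpperCurve :=
    continuous_iff_continuousAt.2 fun s => (beanUpperCurve_hasDerivAt s).continuousAt
  refine Continuous.if_le (h1.comp (continuous_const.mul continuous_id))
    (h2.comp (continuous_const.mul continuous_id)) continuous_id continuous_const ?_
  rintro v rfl
  norm_num [beanLowerCurve, beanUpperCurve]

theorem beanBoundaryLoop_mem {v : ℝ} (hv : v ∈ Icc (0 : ℝ) 1) :
    beanBoundaryLoop v ∈ beanRegion := by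
  rw [beanBoundaryLoop]
  split_ifs with h
  · exact beanLowerCurve_mem ⟨by linarith [hv.1], by linarith⟩
  · exact beanUpperCurve_mem ⟨by linarith, by linarith [hv.2]⟩

theorem beanBoundaryLoop_zero : beanBoundaryLoop 0 = !₂[1, 0] := by
  norm_num [beanBoundaryLoop, beanLowerCurve]

theorem beanBoundaryLoop_one : beanBoundaryLoop 1 = !₂[1, 0] := by
  norm_num [beanBoundaryLoop, beanUpperCurve]

theorem beanBoundaryLoop_sq_ne {v : ℝ} (h : beanBoundaryLoop v 1 = 0) :
    beanBoundaryLoop v 0 ^ 2 ≠ 1 / 2 := by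
  intro h'
  unfold beanBoundaryLoop at h h'
  split_ifs at h h'
  · simp only [beanLowerCurve] at h h'
    have h : (1 - 2 * (3 * v)) ^ 4 / 2 - (1 - 2 * (3 * v)) ^ 2 / 2 = 0 := h
    have h' : (1 - 2 * (3 * v)) ^ 2 = 1 / 2 := h'
    nlinarith
  · have h : 1 - (3 * v - 2) ^ 2 = 0 := h
    have h' : (3 * v - 2) ^ 2 = 1 / 2 := h'
    linarith

theorem beanBoundaryLoop_isSmoothPieceAt {v : ℝ} (hv : v ∈ Ioo (0 : ℝ) 1) (h1 : v ≠ 1 / 6)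
    (h2 : v ≠ 1 / 3) :
    beanSystem.IsSmoothPieceAt (fun s => beanBoundaryLoop (s / 3)) (3 * v) := by
  rcases lt_or_gt_of_ne h2 with h | h
  · refine (beanLowerCurve_isSmoothPieceAt ⟨by linarith [hv.1], by linarith⟩
      (fun h' => h1 (by linarith))).congr ?_
    filter_upwards [Iio_mem_nhds (show 3 * v < 1 by linarith)] with s hs
    rw [beanBoundaryLoop, if_pos (by linarith [mem_Iio.1 hs]), mul_div_cancel₀ _ three_ne_zero]
  · refine (beanUpperCurve_isSmoothPieceAt ⟨by linarith, by linarith [hv.2]⟩).congr ?_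
    filter_upwards [Ioi_mem_nhds (show 1 < 3 * v by linarith)] with s hs
    rw [beanBoundaryLoop, if_neg (by linarith [mem_Ioi.1 hs]), mul_div_cancel₀ _ three_ne_zero]

/-- A time is determined by the floor and the fractional part of `t / c`, each ranging over a finite
set; this bounds the gluing times of a periodic orbit. -/
theorem finite_fract_div_mem_inter_Icc {F : Set ℝ} (hF : F.Finite) {c : ℝ} (hc : 0 < c)
    (a b : ℝ) : ({t : ℝ | Int.fract (t / c) ∈ F} ∩ Icc a b).Finite := by
  refine (((finite_Icc ⌊a / c⌋ ⌊b / c⌋).prod hF).image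
    (fun x : ℤ × ℝ => c * (x.1 + x.2))).subset ?_
  rintro t ⟨ht, ha, hb⟩
  refine ⟨(⌊t / c⌋, Int.fract (t / c)), ⟨⟨Int.floor_mono ?_, Int.floor_mono ?_⟩, ht⟩, ?_⟩
  · gcongr
  · gcongr
  · simp only [Int.floor_add_fract]
    exact mul_div_cancel₀ _ hc.ne'

/-- The periodic orbit along the boundary of the bean. -/
theorem bean_boundary_isOrbit :
    beanSystem.IsOrbit fun t => beanBoundaryLoop (Int.fract (t / 3)) := by
  have hcont : Continuous (beanBoundaryLoop ∘ Int.fract : ℝ → _) :=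
    beanBoundaryLoop_continuous.continuousOn.comp_fract''
      (beanBoundaryLoop_zero.trans beanBoundaryLoop_one.symm)
  have hmem : ∀ t : ℝ, beanBoundaryLoop (Int.fract (t / 3)) ∈ beanRegion := fun t =>
    beanBoundaryLoop_mem ⟨Int.fract_nonneg _, (Int.fract_lt_one _).le⟩
  refine ⟨hcont.comp (continuous_id.div_const 3), hmem,
    -- These phases are the passages through `(1, 0)`, the origin and `(-1, 0)`.
    {t | Int.fract (t / 3) ∈ ({0, 1 / 6, 1 / 3} : Set ℝ)},
    finite_fract_div_mem_inter_Icc (toFinite _) three_pos, fun t ht => ⟨hmem t, ?_⟩,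
    fun t ht => ?_⟩
  · show beanBoundaryLoop (Int.fract (t / 3)) 1 = 0
    rcases ht with h | h | h <;> rw [h] <;> norm_num [beanBoundaryLoop, beanLowerCurve]
  · simp only [mem_ofPred_eq, mem_insert_iff, mem_singleton_iff, not_or] at ht
    obtain ⟨h0, h1, h2⟩ := ht
    set n := ⌊t / 3⌋ with hn
    have hv : Int.fract (t / 3) ∈ Ioo (0 : ℝ) 1 :=
      ⟨(Int.fract_nonneg _).lt_of_ne (Ne.symm h0), Int.fract_lt_one _⟩
    have h3 : 3 * Int.fract (t / 3) = -3 * n + t := by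
      rw [Int.fract]
      ring
    have h4 := beanBoundaryLoop_isSmoothPieceAt hv h1 h2
    rw [h3] at h4
    refine h4.shift.congr ?_
    filter_upwards [Ioo_mem_nhds (show 3 * (n : ℝ) < t by linarith [hv.1])
      (show t < 3 * (n : ℝ) + 3 by linarith [hv.2])] with s hs
    have h5 : ⌊s / 3⌋ = n := Int.floor_eq_iff.2 ⟨by linarith [hs.1], by linarith [hs.2]⟩
    rw [Int.fract, h5]
    congr 1
    ring

/-! ### Tangency points and the main theorem -/

theorem bean_tangencySet :
    beanSystem.tangencySet = {!₂[0, 0], !₂[√2 / 2, 0], !₂[-(√2 / 2), 0]} := by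
  have hs : √2 / 2 * (√2 / 2) = 1 / 2 := by
    have := Real.mul_self_sqrt (zero_le_two (α := ℝ))
    linarith
  ext p
  simp only [mem_insert_iff, mem_singleton_iff]
  constructor
  · rintro ⟨⟨-, h0⟩, h1⟩
    have h0 : p 1 = 0 := h0
    rw [bean_lieDerivPos, bean_lieDerivNeg] at h1
    have h2 : p 0 * (p 0 * ((p 0 - √2 / 2) * (p 0 + √2 / 2))) = 0 := by
      linear_combination (1 / 8 : ℝ) * h1 - p 0 ^ 2 * hs
    have hp : ∀ x, p 0 = x → p = !₂[x, 0] := by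
      intro x hx
      ext i
      fin_cases i
      · simpa using hx
      · simpa using h0
    rcases mul_eq_zero.1 h2 with h | h
    · exact Or.inl (hp _ h)
    · rcases mul_eq_zero.1 h with h | h
      · exact Or.inl (hp _ h)
      · rcases mul_eq_zero.1 h with h | h
        · exact Or.inr (Or.inl (hp _ (by linarith)))
        · exact Or.inr (Or.inr (hp _ (by linarith)))
  · have key : ∀ x : ℝ, x * (x ^ 2 - 1 / 2) = 0 → !₂[x, 0] ∈ beanSystem.tangencySet := by
      intro x hx
      have hx2 : x ^ 2 ≤ 1 / 2 := by
        rcases mul_eq_zero.1 hx with h | h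
        · rw [h]; norm_num
        · linarith
      refine ⟨⟨⟨?_, ?_, ?_, ?_⟩, rfl⟩, ?_⟩
      · show -1 ≤ x
        nlinarith
      · show x ≤ 1
        nlinarith
      · show x ^ 4 / 2 - x ^ 2 / 2 ≤ 0
        nlinarith [sq_nonneg x]
      · show 0 ≤ 1 - x ^ 2
        linarith
      · rw [bean_lieDerivPos, bean_lieDerivNeg]
        show -2 * x * (2 * x - 4 * x ^ 3) = 0
        linear_combination (8 * x) * hx
    rintro (rfl | rfl | rfl)
    · exact key 0 (by ring)
    · exact key _ (by rw [sq, hs]; ring)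
    · exact key _ (by rw [neg_sq, sq, hs]; ring)

theorem bean_zero_mem_switchingSet : !₂[0, 0] ∈ beanSystem.switchingSet := by
  have : !₂[0, 0] ∈ beanSystem.tangencySet := by
    rw [bean_tangencySet]
    exact mem_insert _ _
  exact this.1

theorem mainTheorem10 :
    beanSystem.tangencySet = {!₂[0, 0], !₂[√2 / 2, 0], !₂[-(√2 / 2), 0]} ∧
    (∀ p ∈ beanSystem.tangencySet,
      beanSystem.EveryOrbitRecursThrough p ↔ p = !₂[0, 0]) ∧
    IsTopTransitiveFlow beanSystem.flow ∧
    IsTransitiveFlow beanSystem.flow := by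
  have : Nonempty beanSystem.OrbitSpace := ⟨⟨_, bean_boundary_isOrbit⟩⟩
  refine ⟨bean_tangencySet, fun p hp => ⟨fun hrec => ?_, ?_⟩,
    FilippovSystem.isTopTransitiveFlow_of_recurs bean_zero_mem_switchingSet
      bean_everyOrbitRecursThrough_zero bean_orbitDistControlled,
    FilippovSystem.isTransitiveFlow_of_recurs bean_zero_mem_switchingSet
      bean_everyOrbitRecursThrough_zero bean_orbitDistControlled⟩
  -- The boundary orbit would have to pass through `p`, but it never meets `Σ` where `x² = 1/2`.
  · obtain ⟨t, -, ht⟩ := (hrec ⟨_, bean_boundary_isOrbit⟩ 0).1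
    have ht : beanBoundaryLoop (Int.fract (t / 3)) = p := ht
    have hne := beanBoundaryLoop_sq_ne (v := Int.fract (t / 3))
    rw [ht] at hne
    have hs : (√2 / 2) ^ 2 = 1 / 2 := by
      rw [div_pow, Real.sq_sqrt zero_le_two]
      norm_num
    rw [bean_tangencySet] at hp
    rcases hp with rfl | rfl | rfl
    · rfl
    · exact absurd hs (hne rfl)
    · exact absurd ((neg_sq _).trans hs) (hne rfl)
  · rintro rfl
    exact bean_everyOrbitRecursThrough_zero
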